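/- Let $k \ge 1$ be an integer. A \emph{convex drawing} of a finite simple graph $G=(V,E)$ places the vertices at distinct points in convex position in the plane (no vertex lies in the convex hull of the others) and draws each edge as the straight-line segment between its end vertices; two edges \emph{cross} if they have no common end vertex and their segments share an interior point. The drawing is \emph{outer $k$-quasi-planar} if no $k$ of its edges mutually cross, and a \emph{maximal} outer $k$-quasi-planar drawing if, in addition, inserting any missing edge $uv$ with $u \ne v$, as a segment between the fixed points of $u$ and $v$, yields a drawing that is not outer $k$-quasi-planar. Every maximal outer $k$-quasi-planar drawing of a graph $G=(V,E)$ satisfies \[ |E| = \begin{cases} \binom{|V|}{2} & \text{if } |V| \le 2k-1,\\[2pt] 2(k-1)|V| - \binom{2k-1}{2} & \text{if } |V| \ge 2k-1. \end{cases} \] -/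

import Mathlib

/-- The Euclidean plane. -/
abbrev Plane : Type := EuclideanSpace ℝ (Fin 2)

/-- Two edges of a straight-line drawing with vertex placement `p` cross: they have no common
end vertex, and the line segments that represent them share an interior point. -/
def EdgesCross {V : Type*} (p : V → Plane) (e f : Sym2 V) : Prop :=
  ∃ a b c d : V, e = s(a, b) ∧ f = s(c, d) ∧
    a ≠ c ∧ a ≠ d ∧ b ≠ c ∧ b ≠ d ∧
    (openSegment ℝ (p a) (p b) ∩ openSegment ℝ (p c) (p d)).Nonempty

/-- The straight-line drawing of `G` that places each vertex `v` at the point `p v` is an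
outer `k`-quasi-planar drawing: the vertices are in convex position (they are distinct points,
none of which lies in the convex hull of the others), and no `k` edges mutually cross. -/
structure IsOuterQuasiPlanarDrawing {V : Type*} (k : ℕ) (G : SimpleGraph V) (p : V → Plane) :
    Prop where
  convexPosition : ConvexIndependent ℝ p
  no_mutual_crossing : ¬ ∃ S : Finset (Sym2 V), (S : Set (Sym2 V)) ⊆ G.edgeSet ∧ S.card = k ∧
    (S : Set (Sym2 V)).Pairwise (EdgesCross p)

/-- A maximal outer `k`-quasi-planar drawing: adding any missing edge (as a straight-line segment,
with the same placement of the vertices) destroys outer `k`-quasi-planarity of the drawing. -/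
structure IsMaximalOuterQuasiPlanarDrawing {V : Type*} (k : ℕ) (G : SimpleGraph V)
    (p : V → Plane) : Prop where
  isOuterQuasiPlanarDrawing : IsOuterQuasiPlanarDrawing k G p
  maximal : ∀ u v : V, u ≠ v → ¬ G.Adj u v →
    ¬ IsOuterQuasiPlanarDrawing k (G ⊔ SimpleGraph.edge u v) p

/-! Number the vertices around the polygon and put K = k - 1. Edges become cells (i, j) with i < j <
n, and mutually crossing edges become chains, strictly increasing in both coordinates, inside one
rectangle [0, p) × [p, n).

Read an edge set F as a pipe dream: pipes touch at the cells of F and cross at the others. In any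
routing, the number of pipes with label below p that end in slots from p on is at least the longest
chain of F in the rectangle of p (`IsRouting.chainLength_le`). Equality holds for the sticky
routing, where pipes that have already crossed touch instead of crossing again
(`IsStickyRouting.leftCount_le`).

Let F be maximal. The sticky routing has no contact outside F, since such a cell could be added to F
without lengthening the chains beyond K (`IsMaximalFilling.isReducedRouting`). So the missing edges
correspond to the crossings, and these to the non-inversions of the final permutation u
(`IsReducedRouting.card_compl`). Turning one crossing into a contact multiplies u by a
transposition, and by maximality this violates a rank bound
(`IsMaximalFilling.exists_crossRank_ge`). That forces the shape of u
(`IsRankMaximal.exists_blocks`): the first K and the last K slots exchange their labels as sets, and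
every slot in between is fixed. The non-inversions are the pairs of middle slots, so (n - 2K choose
2) edges are missing whatever F is. -/

/-- The pairs `(i, j)` with `i < j < n`, in bijection with the chords of a convex `n`-gon. -/
def cells (n : ℕ) : Finset (ℕ × ℕ) :=
  (Finset.range n ×ˢ Finset.range n).filter fun c => c.1 < c.2

lemma mem_cells {n : ℕ} {c : ℕ × ℕ} : c ∈ cells n ↔ c.1 < c.2 ∧ c.2 < n := by
  simp only [cells, Finset.mem_filter, Finset.mem_product, Finset.mem_range]
  omega

/-! ### Chains and pipe routings -/

/-- The largest size of a chain of `F` (strictly increasing in both coordinates) in the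
rectangle of the pairs with first coordinate in `[0, i)` and second coordinate in `[p, p + d)`. -/
def chainLength (F : Finset (ℕ × ℕ)) (p : ℕ) : ℕ → ℕ → ℕ
  | 0, _ => 0
  | _ + 1, 0 => 0
  | i + 1, d + 1 => max (max (chainLength F p i (d + 1)) (chainLength F p (i + 1) d))
      (if (i, p + d) ∈ F then chainLength F p i d + 1 else 0)

/-- The states of a family of `n` pipes that traverse the cells `(i, j)`, `i < j < n`, row by row:
`S i j s` is the pipe in slot `s` just before the cell `(i, j)` is passed. The pipes in slots `i`
and `j` must be exchanged at cells of `F`, and may be exchanged at other cells. -/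
structure IsRouting (n : ℕ) (F : Finset (ℕ × ℕ)) (S : ℕ → ℕ → Equiv.Perm ℕ) : Prop where
  init : S 0 0 = 1
  row : ∀ i, S (i + 1) 0 = S i n
  low : ∀ i j, j ≤ i → S i (j + 1) = S i j
  bump : ∀ i j, i < j → (i, j) ∈ F → S i (j + 1) = S i j * Equiv.swap i j
  cell : ∀ i j, i < j → S i (j + 1) = S i j * Equiv.swap i j ∨ S i (j + 1) = S i j

namespace IsRouting

variable {n : ℕ} {F : Finset (ℕ × ℕ)} {S : ℕ → ℕ → Equiv.Perm ℕ}

lemma step_apply (h : IsRouting n F S) {i j s : ℕ} (hi : s ≠ i) (hj : s ≠ j) :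
    S i (j + 1) s = S i j s := by
  rcases Nat.lt_or_ge i j with hij | hij
  · rcases h.cell i j hij with e | e <;> simp [e, Equiv.swap_apply_of_ne_of_ne hi hj]
  · rw [h.low i j hij]

lemma apply_of_le (h : IsRouting n F S) {i j s : ℕ} (hi : s ≠ i) (hj : j ≤ s) :
    S i j s = S i 0 s := by
  induction j with
  | zero => rfl
  | succ j ih => rw [h.step_apply hi (by omega), ih (by omega)]

lemma apply_of_lt (h : IsRouting n F S) {i s j j' : ℕ} (hi : s ≠ i) (hj : s < j) (hjj : j ≤ j') :
    S i j' s = S i j s := by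
  induction j', hjj using Nat.le_induction with
  | base => rfl
  | succ j' hjj ih => rw [h.step_apply hi (by omega), ih]

lemma apply_of_lt_row (h : IsRouting n F S) {i s : ℕ} (j : ℕ) (hs : s < i) :
    S i j s = S i 0 s := by
  induction j with
  | zero => rfl
  | succ j ih =>
    rcases Nat.lt_or_ge i j with hij | hij
    · rw [h.step_apply (by omega) (by omega), ih]
    · rw [h.low i j hij, ih]

lemma apply_of_le_row (h : IsRouting n F S) {p i s : ℕ} (hs : s < p) (hp : p ≤ i) :
    S i 0 s = S p 0 s := by
  induction i, hp using Nat.le_induction with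
  | base => rfl
  | succ i hi ih => rw [h.row, h.apply_of_lt_row n (by omega), ih]

lemma apply_of_ge (h : IsRouting n F S) {s : ℕ} (hs : n ≤ s) :
    ∀ i j, j ≤ n → S i j s = s := by
  have key : ∀ i, S i 0 s = s → ∀ j, j ≤ n → S i j s = s := by
    intro i h0 j
    induction j with
    | zero => exact fun _ => h0
    | succ j ih =>
      intro hj
      rcases Nat.lt_or_ge i j with hij | hij
      · rw [h.step_apply (by omega) (by omega), ih (by omega)]
      · rw [h.low i j hij, ih (by omega)]
  intro i
  induction i with
  | zero => exact key 0 (by simp [h.init])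
  | succ i ih => exact key _ (by rw [h.row]; exact ih n le_rfl)

lemma apply_lt (h : IsRouting n F S) {i j s : ℕ} (hj : j ≤ n) (hs : s < n) : S i j s < n := by
  by_contra hc
  have := h.apply_of_ge (not_lt.1 hc) i j hj
  have := (S i j).injective this
  omega

/-- Before column p, the rows exchange only slots below p, which all start with labels below p. -/
lemma apply_lt_of_lt (h : IsRouting n F S) {p : ℕ} (hp : p ≤ n) :
    ∀ i j s, j ≤ p → i ≤ s → s < p → S i j s < p := by
  have key : ∀ i, (∀ s, i ≤ s → s < p → S i 0 s < p) →
      ∀ j s, j ≤ p → i ≤ s → s < p → S i j s < p := by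
    intro i h0 j
    induction j with
    | zero => exact fun s _ => h0 s
    | succ j ih =>
      intro s hj hs hsp
      rcases Nat.lt_or_ge i j with hij | hij
      · rcases h.cell i j hij with e | e
        · rw [e, Equiv.Perm.mul_apply, Equiv.swap_apply_def]
          split_ifs
          · exact ih j (by omega) (by omega) (by omega)
          · exact ih i (by omega) le_rfl (by omega)
          · exact ih s (by omega) hs hsp
        · rw [e]; exact ih s (by omega) hs hsp
      · rw [h.low i j hij]; exact ih s (by omega) hs hsp
  intro i
  induction i with
  | zero => exact key 0 (by simp [h.init])
  | succ i ih =>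
    refine key _ fun s hs hsp => ?_
    rw [h.row, h.apply_of_lt (j := p) (by omega) hsp hp]
    exact ih p s le_rfl (by omega) hsp

end IsRouting

/-! ### Chain lengths as counts of displaced pipes -/

/-- The number of slots in `[p, p + d)` with a label smaller than `p`. -/
def leftCount (σ : Equiv.Perm ℕ) (p d : ℕ) : ℕ :=
  ∑ x ∈ Finset.range d, if σ (p + x) < p then 1 else 0

lemma leftCount_succ (σ : Equiv.Perm ℕ) (p d : ℕ) :
    leftCount σ p (d + 1) = leftCount σ p d + if σ (p + d) < p then 1 else 0 :=
  Finset.sum_range_succ _ _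

lemma leftCount_congr {σ τ : Equiv.Perm ℕ} {p d : ℕ} (h : ∀ x < d, σ (p + x) = τ (p + x)) :
    leftCount σ p d = leftCount τ p d :=
  Finset.sum_congr rfl fun x hx => by rw [h x (Finset.mem_range.1 hx)]

namespace IsRouting

variable {n : ℕ} {F : Finset (ℕ × ℕ)} {S : ℕ → ℕ → Equiv.Perm ℕ}

lemma leftCount_row_succ (h : IsRouting n F S) {p i d : ℕ} (hi : i < p) (hd : p + d ≤ n) :
    leftCount (S (i + 1) 0) p d = leftCount (S i (p + d)) p d := by
  rw [h.row]
  exact leftCount_congr fun x hx => h.apply_of_lt (by omega) (by omega) hd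

lemma leftCount_step (h : IsRouting n F S) {p i d : ℕ} (hi : i < p) :
    leftCount (S i (p + (d + 1))) p d = leftCount (S i (p + d)) p d :=
  leftCount_congr fun x hx => h.step_apply (j := p + d) (by omega) (by omega)

/-- The pipe that reaches column p in slot i has a label below p. From there on, labels only move
among slot i and the slots from p on, so the number of small labels there is conserved. -/
lemma leftCount_eq_add (h : IsRouting n F S) {p i d : ℕ} (hi : i < p) (hd : p + d ≤ n) :
    leftCount (S i (p + d)) p d =
      leftCount (S i 0) p d + if S i (p + d) i < p then 0 else 1 := by
  induction d with
  | zero => simp [leftCount, h.apply_lt_of_lt (p := p) (by omega) i p i le_rfl le_rfl hi]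
  | succ d ih =>
    have hv : S i (p + d) (p + d) = S i 0 (p + d) := h.apply_of_le (by omega) le_rfl
    rw [leftCount_succ, leftCount_succ, h.leftCount_step hi, ih (by omega), ← hv]
    rcases h.cell i (p + d) (by omega) with e | e <;> rw [← add_assoc, e]
    · simp only [Equiv.Perm.mul_apply, Equiv.swap_apply_left, Equiv.swap_apply_right]
      split_ifs <;> omega
    · split_ifs <;> omega

/-- `leftCount` obeys the recursion of `chainLength` as an inequality: it grows with i and with d,
and a bump at (i, p + d) makes it exactly one more than its value at (i, d). -/
lemma chainLength_le (h : IsRouting n F S) {p i d : ℕ} (hi : i ≤ p) (hd : p + d ≤ n) :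
    chainLength F p i d ≤ leftCount (S i 0) p d := by
  induction i generalizing d with
  | zero => simp [chainLength]
  | succ i ih =>
    induction d with
    | zero => simp [chainLength]
    | succ d ihd =>
      have hv : S i (p + d) (p + d) = S i 0 (p + d) := h.apply_of_le (by omega) le_rfl
      have h1 := ih (d := d + 1) (by omega) hd
      have h2 := ihd (by omega)
      have h3 := ih (d := d) (by omega) (by omega)
      have e1 := h.leftCount_eq_add (i := i) (by omega) hd
      have e2 := h.leftCount_eq_add (p := p) (i := i) (d := d) (by omega) (by omega)
      rw [h.leftCount_row_succ (i := i) (d := d) (by omega) (by omega)] at h2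
      rw [h.leftCount_row_succ (i := i) (by omega) hd]
      rw [chainLength]
      refine max_le (max_le (by omega) (h2.trans ?_)) ?_
      · rw [leftCount_succ, h.leftCount_step (by omega)]; omega
      · split_ifs with hF
        · have hb := h.bump i (p + d) (by omega) hF
          rw [← add_assoc] at e1 ⊢
          rw [e1, hb, leftCount_succ, ← hv]
          simp only [Equiv.Perm.mul_apply, Equiv.swap_apply_left]
          split_ifs <;> omega
        · omega

end IsRouting

/-! ### Sticky routings attain the chain length -/

/-- A routing in which two pipes never cross a second time. -/
structure IsStickyRouting (n : ℕ) (F : Finset (ℕ × ℕ)) (S : ℕ → ℕ → Equiv.Perm ℕ) : Prop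
    extends IsRouting n F S where
  sticky : ∀ i j, i < j → (i, j) ∉ F →
    S i (j + 1) = if S i j j < S i j i then S i j * Equiv.swap i j else S i j

/-- Outside F, a sticky cell leaves the smaller label in slot i and the larger in slot p + d. If the
larger is at least p, the count is that of (i + 1, d); if both are below p, it is that of (i, d +
1). -/
lemma IsStickyRouting.leftCount_le {n : ℕ} {F : Finset (ℕ × ℕ)} {S : ℕ → ℕ → Equiv.Perm ℕ}
    (h : IsStickyRouting n F S) {p i d : ℕ} (hi : i ≤ p) (hd : p + d ≤ n) :
    leftCount (S i 0) p d ≤ chainLength F p i d := by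
  induction i generalizing d with
  | zero => simp [chainLength, h.init, leftCount]
  | succ i ih =>
    induction d with
    | zero => simp [leftCount]
    | succ d ihd =>
      have hv : S i (p + d) (p + d) = S i 0 (p + d) := h.apply_of_le (by omega) le_rfl
      have h1 := ih (d := d + 1) (by omega) hd
      have h2 := ihd (by omega)
      have h3 := ih (d := d) (by omega) (by omega)
      have e2 := h.leftCount_eq_add (p := p) (i := i) (d := d) (by omega) (by omega)
      rw [h.leftCount_row_succ (i := i) (d := d) (by omega) (by omega)] at h2
      rw [h.leftCount_row_succ (i := i) (by omega) hd]
      rw [leftCount_succ, ← hv] at h1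
      rw [chainLength, leftCount_succ, h.leftCount_step (by omega), ← add_assoc]
      by_cases hF : (i, p + d) ∈ F
      · rw [if_pos hF, h.bump i (p + d) (by omega) hF]
        refine le_max_of_le_right ?_
        simp only [Equiv.Perm.mul_apply, Equiv.swap_apply_right]
        split_ifs at * <;> omega
      · refine le_max_of_le_left (le_max_iff.2 ?_)
        rw [h.sticky i (p + d) (by omega) hF]
        have hne : S i (p + d) i ≠ S i (p + d) (p + d) := fun e => by
          have := (S i (p + d)).injective e
          omega
        by_cases hlt : S i (p + d) (p + d) < S i (p + d) i
        · simp only [if_pos hlt, Equiv.Perm.mul_apply, Equiv.swap_apply_right]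
          split_ifs at * <;> omega
        · simp only [if_neg hlt]
          split_ifs at * <;> omega

/-- The sticky routing of `F`. -/
def stickyState (n : ℕ) (F : Finset (ℕ × ℕ)) : ℕ → ℕ → Equiv.Perm ℕ
  | 0, 0 => 1
  | i + 1, 0 => stickyState n F i n
  | i, j + 1 =>
    if i < j ∧ ((i, j) ∈ F ∨ stickyState n F i j j < stickyState n F i j i) then
      stickyState n F i j * Equiv.swap i j
    else stickyState n F i j
  termination_by i j => (i, j)

lemma isStickyRouting_stickyState (n : ℕ) (F : Finset (ℕ × ℕ)) :
    IsStickyRouting n F (stickyState n F) where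
  init := by rw [stickyState]
  row i := by rw [stickyState]
  low i j hij := by rw [stickyState, if_neg (by omega)]
  bump i j hij hF := by rw [stickyState, if_pos ⟨hij, Or.inl hF⟩]
  cell i j hij := by rw [stickyState]; split_ifs <;> simp
  sticky i j hij hF := by
    rw [stickyState]
    simp [hij, hF]

/-! ### Ranks of the outcome -/

/-- The number of slots below `p` with a label at least `p`. -/
def crossRank (u : Equiv.Perm ℕ) (p : ℕ) : ℕ := ((Finset.range p).filter fun s => p ≤ u s).card

/-- There are as many slots below p as labels below p, so equally many labels pass the border at p
in either direction. -/
lemma leftCount_eq_crossRank {n p : ℕ} (hp : p ≤ n) {σ : Equiv.Perm ℕ} (hσ : ∀ s, n ≤ s → σ s = s) :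
    leftCount σ p (n - p) = crossRank σ p := by
  have h1 : leftCount σ p (n - p) = ((Finset.Ico p n).filter fun s => σ s < p).card := by
    rw [leftCount, Finset.card_filter, Finset.sum_Ico_eq_sum_range]
  have h2 : ((Finset.range n).filter fun s => σ s < p).card = p := by
    have : ((Finset.range n).filter fun s => σ s < p) = (Finset.range p).map σ.symm.toEmbedding := by
      ext s
      simp only [Finset.mem_filter, Finset.mem_range, Finset.mem_map_equiv, Equiv.symm_symm]
      refine ⟨fun h => h.2, fun h => ⟨?_, h⟩⟩
      by_contra hc
      rw [hσ s (by omega)] at h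
      omega
    rw [this, Finset.card_map, Finset.card_range]
  have h3 := Finset.card_filter_add_card_filter_not (s := Finset.range p) (fun s => σ s < p)
  have h4 : ((Finset.range n).filter fun s => σ s < p).card =
      ((Finset.range p).filter fun s => σ s < p).card +
        ((Finset.Ico p n).filter fun s => σ s < p).card := by
    simp only [Finset.card_filter, Finset.range_eq_Ico]
    exact (Finset.sum_Ico_consecutive _ (Nat.zero_le p) hp).symm
  simp only [not_lt, Finset.card_range] at h3
  rw [crossRank]
  omega

namespace IsRouting

variable {n : ℕ} {F : Finset (ℕ × ℕ)} {S : ℕ → ℕ → Equiv.Perm ℕ}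

lemma leftCount_eq (h : IsRouting n F S) {p : ℕ} (hp : p ≤ n) :
    leftCount (S p 0) p (n - p) = crossRank (S n 0) p := by
  rw [leftCount_eq_crossRank hp fun s hs => h.apply_of_ge hs p 0 (Nat.zero_le _), crossRank,
    crossRank]
  congr 1
  refine Finset.filter_congr fun s hs => ?_
  -- Rows from p on leave the slots below p alone.
  rw [h.apply_of_le_row (Finset.mem_range.1 hs) hp]

lemma chainLength_le_crossRank (h : IsRouting n F S) {p : ℕ} (hp : p ≤ n) :
    chainLength F p p (n - p) ≤ crossRank (S n 0) p :=
  h.leftCount_eq hp ▸ h.chainLength_le le_rfl (by omega)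

end IsRouting

lemma IsStickyRouting.crossRank_le_chainLength {n : ℕ} {F : Finset (ℕ × ℕ)}
    {S : ℕ → ℕ → Equiv.Perm ℕ} (h : IsStickyRouting n F S) {p : ℕ} (hp : p ≤ n) :
    crossRank (S n 0) p ≤ chainLength F p p (n - p) :=
  h.leftCount_eq hp ▸ h.leftCount_le le_rfl (by omega)

/-! ### Maximal fillings give reduced routings -/

/-- A routing in which every two pipes cross at most once, and exactly at the cells outside `F`. -/
structure IsReducedRouting (n : ℕ) (F : Finset (ℕ × ℕ)) (S : ℕ → ℕ → Equiv.Perm ℕ) : Prop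
    extends IsRouting n F S where
  cross : ∀ i j, i < j → j < n → (i, j) ∉ F → S i (j + 1) = S i j ∧ S i j i < S i j j

/-- `F` has no chain of more than `K` cells within a rectangle, and is maximal with this property. -/
structure IsMaximalFilling (n K : ℕ) (F : Finset (ℕ × ℕ)) : Prop where
  chainLength_le : ∀ p ≤ n, chainLength F p p (n - p) ≤ K
  maximal : ∀ c ∈ cells n, c ∉ F → ∃ p ≤ n, K < chainLength (insert c F) p p (n - p)

lemma IsMaximalFilling.isReducedRouting {n K : ℕ} {F : Finset (ℕ × ℕ)}
    {S : ℕ → ℕ → Equiv.Perm ℕ} (hF : IsMaximalFilling n K F) (h : IsStickyRouting n F S) :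
    IsReducedRouting n F S where
  toIsRouting := h.toIsRouting
  cross i j hij hj hc := by
    have hlt : ¬ S i j j < S i j i := by
      intro hlt
      obtain ⟨p, hp, hp'⟩ := hF.maximal (i, j) (mem_cells.2 ⟨hij, hj⟩) hc
      -- An exchange at a cell outside F makes the same states a routing of the larger filling,
      -- whose chains are then bounded by the unchanged ranks.
      have hr : IsRouting n (insert (i, j) F) S :=
        { h.toIsRouting with
          bump := fun a b hab hm => by
            rcases Finset.mem_insert.1 hm with e | hm
            · obtain ⟨rfl, rfl⟩ := Prod.mk.inj e
              rw [h.sticky _ _ hij hc, if_pos hlt]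
            · exact h.bump a b hab hm }
      have h1 := hr.chainLength_le_crossRank hp
      have h2 := h.crossRank_le_chainLength hp
      have h3 := hF.chainLength_le p hp
      omega
    refine ⟨by rw [h.sticky _ _ hij hc, if_neg hlt], ?_⟩
    have hne : S i j i ≠ S i j j := fun e => by
      have := (S i j).injective e
      omega
    omega

/-! ### Crossings and non-inversions -/

/-- The position of the slot `s` along the frontier between the passed and the remaining cells, just
before the cell `(i, j)` is passed. -/
def frontierPos (n i j s : ℕ) : ℕ :=
  if s < i then 4 * n - s else if s = i then max (2 * i) (2 * j - 1) else 2 * s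

/-- `1` if the pipe `x` comes before the pipe `y` along the frontier, `0` otherwise. -/
def pipeBefore (n : ℕ) (S : ℕ → ℕ → Equiv.Perm ℕ) (i j x y : ℕ) : ℕ :=
  if frontierPos n i j ((S i j).symm x) < frontierPos n i j ((S i j).symm y) then 1 else 0

namespace IsReducedRouting

variable {n : ℕ} {F : Finset (ℕ × ℕ)} {S : ℕ → ℕ → Equiv.Perm ℕ}

lemma symm_lt (h : IsRouting n F S) {i j x : ℕ} (hj : j ≤ n) (hx : x < n) :
    (S i j).symm x < n := by
  by_contra hc
  have := h.apply_of_ge (not_lt.1 hc) i j hj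
  rw [Equiv.apply_symm_apply] at this
  omega

/-- Passing (i, j) moves slot i from position 2j - 1 to 2j + 1, across slot j at 2j. At a crossing
the two neighbouring pipes thus change order; at a contact the exchange of labels restores it. -/
lemma pipeBefore_step (h : IsReducedRouting n F S) {i j x y : ℕ} (hij : i < j) (hj : j < n)
    (hx : x < n) (hxy : x < y) (hy : y < n) :
    pipeBefore n S i j x y = pipeBefore n S i (j + 1) x y +
      if (i, j) ∉ F ∧ S i j i = x ∧ S i j j = y then 1 else 0 := by
  obtain ⟨a, rfl⟩ := (S i j).surjective x
  obtain ⟨b, rfl⟩ := (S i j).surjective y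
  have ha : a < n := by simpa using symm_lt h.toIsRouting (i := i) (j := j) hj.le hx
  have hb : b < n := by simpa using symm_lt h.toIsRouting (i := i) (j := j) hj.le hy
  have hab : a ≠ b := by rintro rfl; omega
  simp only [pipeBefore, (S i j).injective.eq_iff, Equiv.symm_apply_apply]
  by_cases hF : (i, j) ∈ F
  · have e : ∀ c, (S i (j + 1)).symm (S i j c) = Equiv.swap i j c := fun c => by
      rw [h.bump i j hij hF, Equiv.symm_apply_eq]; simp
    simp only [e, hF, not_true_eq_false, false_and, if_false, add_zero]
    congr 1
    simp only [Equiv.swap_apply_def, frontierPos, eq_iff_iff]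
    split_ifs <;> omega
  · obtain ⟨e, hlt⟩ := h.cross i j hij hj hF
    simp only [e, Equiv.symm_apply_apply, hF, not_false_eq_true, true_and]
    have hba : ¬ (b = i ∧ a = j) := by rintro ⟨rfl, rfl⟩; omega
    simp only [frontierPos]
    split_ifs <;> omega

lemma pipeBefore_low (h : IsReducedRouting n F S) {i j x y : ℕ} (hij : j ≤ i) (hj : j ≤ n)
    (hx : x < n) (hy : y < n) :
    pipeBefore n S i (j + 1) x y = pipeBefore n S i j x y := by
  have ha := symm_lt h.toIsRouting (i := i) hj hx
  have hb := symm_lt h.toIsRouting (i := i) hj hy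
  simp only [pipeBefore, h.low i j hij]
  congr 1
  simp only [frontierPos, eq_iff_iff]
  split_ifs <;> omega

lemma sum_row (h : IsReducedRouting n F S) {i x y : ℕ}
    (hx : x < n) (hxy : x < y) (hy : y < n) {j : ℕ} (hj : j ≤ n) :
    pipeBefore n S i 0 x y = pipeBefore n S i j x y + ∑ b ∈ Finset.range j,
      if i < b ∧ (i, b) ∉ F ∧ S i b i = x ∧ S i b b = y then 1 else 0 := by
  induction j with
  | zero => simp
  | succ j ih =>
    rw [Finset.sum_range_succ, ih (by omega)]
    rcases Nat.lt_or_ge i j with hij | hij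
    · rw [h.pipeBefore_step hij (by omega) hx hxy hy]
      simp only [hij, true_and]
      ring
    · rw [h.pipeBefore_low hij (by omega) (by omega) hy, if_neg (by omega)]
      ring

lemma pipeBefore_row (h : IsReducedRouting n F S) {i x y : ℕ} (hi : i < n)
    (hx : x < n) (hy : y < n) :
    pipeBefore n S (i + 1) 0 x y = pipeBefore n S i n x y := by
  simp only [pipeBefore, h.row]
  have ha := symm_lt h.toIsRouting (i := i) (j := n) le_rfl hx
  have hb := symm_lt h.toIsRouting (i := i) (j := n) le_rfl hy
  congr 1
  simp only [frontierPos, eq_iff_iff]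
  split_ifs <;> omega

lemma sum_rows (h : IsReducedRouting n F S) {x y : ℕ}
    (hx : x < n) (hxy : x < y) (hy : y < n) {i : ℕ} (hi : i ≤ n) :
    1 = pipeBefore n S i 0 x y + ∑ a ∈ Finset.range i, ∑ b ∈ Finset.range n,
      if a < b ∧ (a, b) ∉ F ∧ S a b a = x ∧ S a b b = y then 1 else 0 := by
  induction i with
  | zero =>
    have e : ∀ z, (1 : Equiv.Perm ℕ).symm z = z := fun _ => rfl
    have hlt : frontierPos n 0 0 x < frontierPos n 0 0 y := by
      simp only [frontierPos]
      split_ifs <;> omega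
    simp [pipeBefore, h.init, e, hlt]
  | succ i ih =>
    have h1 := ih (by omega)
    have h2 := h.sum_row (i := i) hx hxy hy le_rfl
    rw [Finset.sum_range_succ, h.pipeBefore_row (by omega) hx hy]
    omega

/-- Two pipes cross exactly once if they leave in the order in which they came, and never
otherwise. -/
lemma card_crossings (h : IsReducedRouting n F S) {x y : ℕ}
    (hx : x < n) (hxy : x < y) (hy : y < n) :
    ((cells n \ F).filter fun c => (S c.1 c.2 c.1, S c.1 c.2 c.2) = (x, y)).card =
      if (S n 0).symm x < (S n 0).symm y then 1 else 0 := by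
  have h1 := h.sum_rows hx hxy hy le_rfl
  -- After the last row, slot s is at position 4n - s, so the order along the frontier is the
  -- reverse of the slot order.
  have h2 : pipeBefore n S n 0 x y = if (S n 0).symm y < (S n 0).symm x then 1 else 0 := by
    have ha := symm_lt h.toIsRouting (i := n) (j := 0) (Nat.zero_le _) hx
    have hb := symm_lt h.toIsRouting (i := n) (j := 0) (Nat.zero_le _) hy
    simp only [pipeBefore, frontierPos, ha, hb, if_true]
    congr 1
    simp only [eq_iff_iff]
    omega
  have h3 : ((cells n \ F).filter fun c => (S c.1 c.2 c.1, S c.1 c.2 c.2) = (x, y)).card =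
      ∑ a ∈ Finset.range n, ∑ b ∈ Finset.range n,
        if a < b ∧ (a, b) ∉ F ∧ S a b a = x ∧ S a b b = y then 1 else 0 := by
    rw [← Finset.sum_product', ← Finset.card_filter]
    congr 1
    ext ⟨a, b⟩
    simp only [cells, Finset.mem_filter, Finset.mem_sdiff, Finset.mem_product, Prod.mk.injEq]
    tauto
  have hne : (S n 0).symm x ≠ (S n 0).symm y := fun e => by
    have := (S n 0).symm.injective e
    omega
  rw [h3]
  rw [h2] at h1
  split_ifs at * <;> omega

/-- The number of cells outside `F` is the number of non-inversions of the outcome. -/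
lemma card_compl (h : IsReducedRouting n F S) :
    (cells n \ F).card = ((cells n).filter fun c => S n 0 c.1 < S n 0 c.2).card := by
  have hmaps : ∀ c ∈ cells n \ F, (S c.1 c.2 c.1, S c.1 c.2 c.2) ∈ cells n := by
    rintro ⟨i, j⟩ hc
    obtain ⟨hc, hF⟩ := Finset.mem_sdiff.1 hc
    obtain ⟨hij, hj⟩ := mem_cells.1 hc
    exact mem_cells.2 ⟨(h.cross i j hij hj hF).2, h.apply_lt hj.le hj⟩
  rw [Finset.card_eq_sum_card_fiberwise hmaps]
  have : ∀ c ∈ cells n, ((cells n \ F).filter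
      fun c' => (S c'.1 c'.2 c'.1, S c'.1 c'.2 c'.2) = c).card =
        if (S n 0).symm c.1 < (S n 0).symm c.2 then 1 else 0 := by
    rintro ⟨x, y⟩ hc
    obtain ⟨hxy, hy⟩ := mem_cells.1 hc
    exact h.card_crossings (lt_trans hxy hy) hxy hy
  rw [Finset.sum_congr rfl this, ← Finset.card_filter]
  have hlt : ∀ s, s < n → S n 0 s < n := fun s => h.apply_lt (Nat.zero_le _)
  have hlt' : ∀ s, s < n → (S n 0).symm s < n := fun s => symm_lt h.toIsRouting (Nat.zero_le _)
  refine Finset.card_nbij' (fun c => ((S n 0).symm c.1, (S n 0).symm c.2))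
    (fun c => (S n 0 c.1, S n 0 c.2)) ?_ ?_ ?_ ?_
  · rintro ⟨x, y⟩ hc
    simp only [Finset.coe_filter, mem_cells, Set.mem_ofPred_eq, Equiv.apply_symm_apply] at hc ⊢
    exact ⟨⟨hc.2, hlt' _ hc.1.2⟩, hc.1.1⟩
  · rintro ⟨x, y⟩ hc
    simp only [Finset.coe_filter, mem_cells, Set.mem_ofPred_eq, Equiv.symm_apply_apply] at hc ⊢
    exact ⟨⟨hc.2, hlt _ hc.1.2⟩, hc.1.1⟩
  · rintro ⟨x, y⟩ -; simp
  · rintro ⟨x, y⟩ -; simp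

/-- Turning the crossing of two pipes into a contact exchanges the two pipes from then on. -/
lemma isRouting_insert (h : IsReducedRouting n F S) {i₀ j₀ : ℕ} (hij₀ : i₀ < j₀) (hj₀ : j₀ < n)
    (hF : (i₀, j₀) ∉ F) :
    IsRouting n (insert (i₀, j₀) F) fun i j => if i₀ < i ∨ i = i₀ ∧ j₀ < j then
      Equiv.swap (S i₀ j₀ i₀) (S i₀ j₀ j₀) * S i j else S i j where
  init := by simp [h.init]
  row i := by
    have : (i₀ < i + 1 ∨ i + 1 = i₀ ∧ j₀ < 0) ↔ (i₀ < i ∨ i = i₀ ∧ j₀ < n) := by omega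
    simp only [this, h.row]
  low i j hij := by
    have : (i₀ < i ∨ i = i₀ ∧ j₀ < j + 1) ↔ (i₀ < i ∨ i = i₀ ∧ j₀ < j) := by omega
    simp only [this, h.low i j hij]
  bump i j hij hm := by
    by_cases hne : i = i₀ ∧ j = j₀
    · obtain ⟨rfl, rfl⟩ := hne
      -- Exchanging two slots is exchanging the labels they hold. As a left factor, this exchange
      -- passes unchanged through all later steps.
      rw [if_pos (by omega), if_neg (by omega), (h.cross i j hij hj₀ hF).1,
        Equiv.mul_swap_eq_swap_mul]
    · have hm : (i, j) ∈ F := by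
        rcases Finset.mem_insert.1 hm with e | hm
        · exact absurd (Prod.mk.inj e) hne
        · exact hm
      have : (i₀ < i ∨ i = i₀ ∧ j₀ < j + 1) ↔ (i₀ < i ∨ i = i₀ ∧ j₀ < j) := by omega
      simp only [this, h.bump i j hij hm]
      split_ifs <;> simp [mul_assoc]
  cell i j hij := by
    by_cases hc : i = i₀ ∧ j = j₀
    · obtain ⟨rfl, rfl⟩ := hc
      left
      rw [if_pos (by omega), if_neg (by omega), (h.cross i j hij hj₀ hF).1,
        Equiv.mul_swap_eq_swap_mul]
    · have : (i₀ < i ∨ i = i₀ ∧ j₀ < j + 1) ↔ (i₀ < i ∨ i = i₀ ∧ j₀ < j) := by omega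
      simp only [this]
      rcases h.cell i j hij with e | e
      · left; rw [e]; split_ifs <;> simp [mul_assoc]
      · right; rw [e]

end IsReducedRouting

/-- Below p, at most slot a changes its label as long as b is not below p; otherwise the exchange
only permutes the slots that are counted. -/
lemma crossRank_mul_swap_le (u : Equiv.Perm ℕ) {a b p : ℕ} (hab : a < b) (hu : u a < u b) :
    crossRank (u * Equiv.swap a b) p ≤ crossRank u p +
      if a < p ∧ p ≤ b ∧ u a < p ∧ p ≤ u b then 1 else 0 := by
  unfold crossRank
  rcases Nat.lt_or_ge b p with hb | hb
  · refine le_add_right (le_of_eq ?_)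
    refine Finset.card_nbij' (Equiv.swap a b) (Equiv.swap a b) ?_ ?_ ?_ ?_
    · intro s hs
      simp only [Finset.coe_filter, Finset.mem_range, Set.mem_ofPred_eq] at hs ⊢
      rw [Equiv.Perm.mul_apply] at hs
      refine ⟨?_, hs.2⟩
      rw [Equiv.swap_apply_def]; split_ifs <;> omega
    · intro s hs
      simp only [Finset.coe_filter, Finset.mem_range, Set.mem_ofPred_eq] at hs ⊢
      rw [Equiv.Perm.mul_apply, Equiv.swap_apply_self]
      refine ⟨?_, hs.2⟩
      rw [Equiv.swap_apply_def]; split_ifs <;> omega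
    · intro s _; simp
    · intro s _; simp
  · have key : ∀ s < p, s ≠ a → (u * Equiv.swap a b) s = u s := fun s hs hsa => by
      rw [Equiv.Perm.mul_apply, Equiv.swap_apply_of_ne_of_ne hsa (by omega)]
    have ea : (u * Equiv.swap a b) a = u b := by simp
    split_ifs with hc
    · refine (Finset.card_le_card (t := insert a ((Finset.range p).filter fun s => p ≤ u s)) ?_).trans
        (Finset.card_insert_le _ _)
      intro s hs
      simp only [Finset.mem_filter, Finset.mem_range, Finset.mem_insert] at hs ⊢
      by_cases hsa : s = a
      · exact Or.inl hsa
      · exact Or.inr ⟨hs.1, key s hs.1 hsa ▸ hs.2⟩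
    · rw [add_zero]
      refine Finset.card_le_card ?_
      intro s hs
      simp only [Finset.mem_filter, Finset.mem_range] at hs ⊢
      by_cases hsa : s = a
      · subst hsa
        rw [ea] at hs
        omega
      · exact ⟨hs.1, key s hs.1 hsa ▸ hs.2⟩

/-- The outcome of the routing of a maximal filling admits no exchange that respects the bound on the
ranks. -/
lemma IsMaximalFilling.exists_crossRank_ge {n K : ℕ} {F : Finset (ℕ × ℕ)}
    {S : ℕ → ℕ → Equiv.Perm ℕ} (hF : IsMaximalFilling n K F) (h : IsReducedRouting n F S)
    (hle : ∀ p ≤ n, crossRank (S n 0) p ≤ K)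
    {a b : ℕ} (hab : a < b) (hb : b < n) (hu : S n 0 a < S n 0 b) :
    ∃ p, a < p ∧ p ≤ b ∧ S n 0 a < p ∧ p ≤ S n 0 b ∧ K ≤ crossRank (S n 0) p := by
  have hbn : S n 0 b < n := h.apply_lt (Nat.zero_le _) hb
  have hcard := h.card_crossings (hu.trans hbn) hu hbn
  simp only [Equiv.symm_apply_apply, if_pos hab] at hcard
  obtain ⟨⟨i, j⟩, hc⟩ := Finset.card_pos.1 (hcard ▸ Nat.one_pos)
  simp only [Finset.mem_filter, Finset.mem_sdiff, mem_cells, Prod.mk.injEq] at hc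
  obtain ⟨⟨⟨hij, hj⟩, hnF⟩, hx, hy⟩ := hc
  obtain ⟨p, hp, hlt⟩ := hF.maximal (i, j) (mem_cells.2 ⟨hij, hj⟩) hnF
  have h1 := (h.isRouting_insert hij hj hnF).chainLength_le_crossRank hp
  rw [if_pos (Or.inl (hij.trans hj)), hx, hy, ← Equiv.mul_swap_eq_swap_mul] at h1
  have h2 := crossRank_mul_swap_le (S n 0) (p := p) hab hu
  have h3 := hle p hp
  split_ifs at h2 with hc
  · exact ⟨p, hc.1, hc.2.1, hc.2.2.1, hc.2.2.2, by omega⟩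
  · omega

/-! ### The shape of rank-maximal permutations -/

/-- From p to p + 1, slot p joins the slots that are inspected, and label p stops being large. -/
lemma crossRank_succ (u : Equiv.Perm ℕ) (p : ℕ) :
    crossRank u (p + 1) + (if u.symm p < p then 1 else 0) =
      crossRank u p + if p < u p then 1 else 0 := by
  have h1 : crossRank u (p + 1) = ((Finset.range p).filter fun s => p < u s).card +
      if p < u p then 1 else 0 := by
    simp only [crossRank, Finset.card_filter, Finset.sum_range_succ, Nat.succ_le_iff]
  have h2 : crossRank u p = ((Finset.range p).filter fun s => p < u s).card +
      if u.symm p < p then 1 else 0 := by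
    have h3 : ∀ s, (if p ≤ u s then 1 else 0) =
        (if p < u s then 1 else 0) + if s = u.symm p then 1 else 0 := fun s => by
      have : s = u.symm p ↔ u s = p := Equiv.eq_symm_apply u
      split_ifs <;> omega
    simp only [crossRank, Finset.card_filter, h3, Finset.sum_add_distrib, Finset.sum_ite_eq',
      Finset.mem_range]
  omega

lemma crossRank_zero (u : Equiv.Perm ℕ) : crossRank u 0 = 0 := by simp [crossRank]

/-- Permutations of `[0, n)` with ranks at most `K` which are maximal among these with respect to the
exchange of the values of a non-inversion. -/
structure IsRankMaximal (n K : ℕ) (u : Equiv.Perm ℕ) : Prop where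
  fix : ∀ s, n ≤ s → u s = s
  le : ∀ p ≤ n, crossRank u p ≤ K
  exists_ge : ∀ a b, a < b → b < n → u a < u b →
    ∃ p, a < p ∧ p ≤ b ∧ u a < p ∧ p ≤ u b ∧ K ≤ crossRank u p

namespace IsRankMaximal

variable {n K : ℕ} {u : Equiv.Perm ℕ}

lemma apply_lt (h : IsRankMaximal n K u) {s : ℕ} (hs : s < n) : u s < n := by
  by_contra hc
  have := u.injective (h.fix _ (not_lt.1 hc))
  omega

lemma symm_lt (h : IsRankMaximal n K u) {s : ℕ} (hs : s < n) : u.symm s < n := by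
  by_contra hc
  have := h.fix _ (not_lt.1 hc)
  rw [Equiv.apply_symm_apply] at this
  omega

/-- If p were strictly between `u.symm p` and `u p`, these two slots, p among them, would form a
non-inversion whose slot interval and label interval meet at p only, which leaves no cut separating
both. Hence exceedances and anti-exceedances alone govern how the rank changes. -/
lemma symm_lt_iff (h : IsRankMaximal n K u) {p : ℕ} (hp : p < n) : u.symm p < p ↔ u p < p := by
  have e : u (u.symm p) = p := u.apply_symm_apply p
  have hne : u p = p ↔ u.symm p = p := by rw [Equiv.symm_apply_eq, eq_comm]
  constructor
  · intro hlt
    by_contra hc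
    have : u p ≠ p := fun hh => by have := hne.1 hh; omega
    obtain ⟨q, h1, h2, h3, h4, -⟩ := h.exists_ge (u.symm p) p hlt hp (by omega)
    omega
  · intro hlt
    by_contra hc
    have : u.symm p ≠ p := fun hh => by have := hne.2 hh; omega
    obtain ⟨q, h1, h2, h3, h4, -⟩ := h.exists_ge p (u.symm p) (by omega) (h.symm_lt hp) (by omega)
    omega

lemma lt_symm_iff (h : IsRankMaximal n K u) {p : ℕ} (hp : p < n) : p < u.symm p ↔ p < u p := by
  have hne : u p = p ↔ u.symm p = p := by rw [Equiv.symm_apply_eq, eq_comm]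
  have := h.symm_lt_iff hp
  omega

lemma crossRank_succ_eq (h : IsRankMaximal n K u) {p : ℕ} (hp : p < n) :
    crossRank u (p + 1) + (if u p < p then 1 else 0) = crossRank u p + if p < u p then 1 else 0 := by
  rw [← crossRank_succ]
  simp only [h.symm_lt_iff hp]

/-- The slots f and f + 1 form a non-inversion, and f + 1 is the only cut between them. With the
rank already K there, an exceedance at f + 1 or an anti-exceedance at f would put K + 1 at a
neighbouring cut. -/
lemma le_crossRank_succ (h : IsRankMaximal n K u) {f : ℕ} (hf : f + 1 < n) (h1 : u f ≤ f)
    (h2 : f + 1 ≤ u (f + 1)) : K ≤ crossRank u (f + 1) := by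
  obtain ⟨p, a, b, c, d, e⟩ := h.exists_ge f (f + 1) (by omega) hf (by omega)
  obtain rfl : p = f + 1 := by omega
  exact e

lemma apply_succ_le (h : IsRankMaximal n K u) {f : ℕ} (hf : f + 1 < n) (h1 : u f ≤ f) :
    u (f + 1) ≤ f + 1 := by
  by_contra hc
  have h2 := h.le_crossRank_succ hf h1 (by omega)
  have h3 := h.crossRank_succ_eq hf
  have h4 := h.le (f + 1 + 1) hf
  split_ifs at h3 <;> omega

lemma apply_succ_lt (h : IsRankMaximal n K u) {f : ℕ} (hf : f + 1 < n) (h1 : u f < f) :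
    u (f + 1) < f + 1 := by
  have h0 := h.apply_succ_le hf h1.le
  by_contra hc
  have h2 := h.le_crossRank_succ hf h1.le (by omega)
  have h3 := h.crossRank_succ_eq (p := f) (by omega)
  have h4 := h.le f (by omega)
  split_ifs at h3 <;> omega

lemma apply_le_mono (h : IsRankMaximal n K u) {f g : ℕ} (hfg : f ≤ g) (hg : g < n) (h1 : u f ≤ f) :
    u g ≤ g := by
  induction g, hfg using Nat.le_induction with
  | base => exact h1
  | succ g hfg ih => exact h.apply_succ_le hg (ih (by omega))

lemma apply_lt_mono (h : IsRankMaximal n K u) {f g : ℕ} (hfg : f ≤ g) (hg : g < n) (h1 : u f < f) :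
    u g < g := by
  induction g, hfg using Nat.le_induction with
  | base => exact h1
  | succ g hfg ih => exact h.apply_succ_lt hg (ih (by omega))

lemma crossRank_last (h : IsRankMaximal n K u) : crossRank u n = 0 := by
  rw [crossRank, Finset.card_eq_zero, Finset.filter_eq_empty_iff]
  intro s hs
  have := h.apply_lt (Finset.mem_range.1 hs)
  omega

/-- Exceedances come first, then fixed points, then anti-exceedances. -/
lemma exists_blocks (h : IsRankMaximal n K u) (hn : 2 * K ≤ n) :
    ∀ p < n, (p < u p ↔ p < K) ∧ (u p < p ↔ n - K ≤ p) := by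
  obtain ⟨m, hmn, hm1, hm2⟩ : ∃ m ≤ n, (∀ p < m, p < u p) ∧ ∀ p < n, m ≤ p → u p ≤ p := by
    have hex : ∃ m, u m ≤ m := ⟨n, (h.fix n le_rfl).le⟩
    refine ⟨Nat.find hex, Nat.find_min' hex (h.fix n le_rfl).le, fun p hp => ?_, fun p hp hmp => ?_⟩
    · exact not_le.1 (Nat.find_min hex hp)
    · exact h.apply_le_mono hmp hp (Nat.find_spec hex)
  obtain ⟨l, hln, hl1, hl2⟩ : ∃ l ≤ n, (∀ p < l, p ≤ u p) ∧ ∀ p < n, l ≤ p → u p < p := by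
    have hex : ∃ l, u l < l ∨ n ≤ l := ⟨n, Or.inr le_rfl⟩
    refine ⟨Nat.find hex, Nat.find_min' hex (Or.inr le_rfl), fun p hp => ?_, fun p hp hmp => ?_⟩
    · exact not_lt.1 fun hc => Nat.find_min hex hp (Or.inl hc)
    · rcases Nat.find_spec hex with hs | hs
      · exact h.apply_lt_mono hmp hp hs
      · omega
  have hml : m ≤ l := by
    by_contra hc
    have := hm1 l (by omega)
    have := hl2 l (by omega) le_rfl
    omega
  -- The rank climbs by one along the exceedances, stays at m on the fixed points and falls by one
  -- along the anti-exceedances. As it ends at 0, there are m anti-exceedances too.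
  have r1 : ∀ p ≤ m, crossRank u p = p := by
    intro p
    induction p with
    | zero => simp [crossRank_zero]
    | succ p ih =>
      intro hp
      have := h.crossRank_succ_eq (p := p) (by omega)
      have := ih (by omega)
      have := hm1 p (by omega)
      split_ifs at * <;> omega
  have r2 : ∀ p, m ≤ p → p ≤ l → crossRank u p = m := by
    intro p hp
    induction p, hp using Nat.le_induction with
    | base => exact fun _ => r1 m le_rfl
    | succ p hp ih =>
      intro hpl
      have := h.crossRank_succ_eq (p := p) (by omega)
      have := ih (by omega)
      have := hl1 p (by omega)
      have := hm2 p (by omega) hp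
      split_ifs at * <;> omega
  have r3 : ∀ p, l ≤ p → p ≤ n → crossRank u p + (p - l) = m := by
    intro p hp
    induction p, hp using Nat.le_induction with
    | base => exact fun _ => by simp [r2 l hml le_rfl]
    | succ p hp ih =>
      intro hpn
      have := h.crossRank_succ_eq (p := p) (by omega)
      have := ih (by omega)
      have := hl2 p (by omega) hp
      split_ifs at * <;> omega
  have e1 := r3 n hln le_rfl
  rw [h.crossRank_last] at e1
  have e2 := h.le m hmn
  rw [r1 m le_rfl] at e2
  -- If m < K, then n - 2m ≥ 2 leaves two adjacent fixed points, a non-inversion whose only cut has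
  -- rank m < K.
  have e3 : m = K := by
    by_contra hne
    have h1 := hm2 m (by omega) le_rfl
    have h2 := hl1 (m + 1) (by omega)
    have h3 := h.le_crossRank_succ (f := m) (by omega) h1 h2
    rw [r2 (m + 1) (by omega) (by omega)] at h3
    omega
  intro p hp
  have a1 := hm1 p
  have a2 := hm2 p hp
  have a3 := hl1 p
  have a4 := hl2 p hp
  omega

/-- By `symm_lt_iff` and `lt_symm_iff`, the label of an exceedance is the position of an
anti-exceedance and vice versa. So the first and last K slots exchange labels, and `exists_ge` rules
out non-inversions within or between these blocks. -/
lemma apply_lt_apply_iff (h : IsRankMaximal n K u) (hn : 2 * K ≤ n) {a b : ℕ} (hab : a < b)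
    (hb : b < n) : u a < u b ↔ K ≤ a ∧ b < n - K := by
  have B := h.exists_blocks hn
  have ha := B a (by omega)
  have hb' := B b hb
  have hua := h.apply_lt (s := a) (by omega)
  have hub := h.apply_lt hb
  have Bua := B _ hua
  have Bub := B _ hub
  have sa := h.symm_lt_iff hua
  have sb := h.symm_lt_iff hub
  have ta := h.lt_symm_iff hua
  have tb := h.lt_symm_iff hub
  rw [Equiv.symm_apply_apply] at sa sb ta tb
  constructor
  · intro hu
    obtain ⟨p, h1, h2, h3, h4, -⟩ := h.exists_ge a b hab hb hu
    omega
  · intro hu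
    omega

end IsRankMaximal

lemma card_cells (n : ℕ) : (cells n).card = n.choose 2 := by
  have h1 : (cells n).card = ∑ j ∈ Finset.range n, j := by
    rw [cells, Finset.card_filter, Finset.sum_product_right]
    refine Finset.sum_congr rfl fun j hj => ?_
    rw [← Finset.card_filter]
    have : ((Finset.range n).filter fun i => i < j) = Finset.range j := by
      ext i
      simp only [Finset.mem_filter, Finset.mem_range] at hj ⊢
      omega
    rw [this, Finset.card_range]
  rw [h1, Finset.sum_range_id, Nat.choose_two_right]

lemma IsRankMaximal.card_filter_lt {n K : ℕ} {u : Equiv.Perm ℕ} (h : IsRankMaximal n K u)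
    (hn : 2 * K ≤ n) :
    ((cells n).filter fun c => u c.1 < u c.2).card = (n - 2 * K).choose 2 := by
  rw [← card_cells]
  refine Finset.card_nbij' (fun c => (c.1 - K, c.2 - K)) (fun c => (c.1 + K, c.2 + K)) ?_ ?_ ?_ ?_
  · rintro ⟨a, b⟩ hc
    simp only [Finset.coe_filter, Set.mem_ofPred_eq, mem_cells, Finset.mem_coe] at hc ⊢
    have := (h.apply_lt_apply_iff hn hc.1.1 hc.1.2).1 hc.2
    omega
  · rintro ⟨a, b⟩ hc
    simp only [Finset.coe_filter, Set.mem_ofPred_eq, mem_cells, Finset.mem_coe] at hc ⊢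
    refine ⟨by omega, (h.apply_lt_apply_iff hn (by omega) (by omega)).2 (by omega)⟩
  · rintro ⟨a, b⟩ hc
    simp only [Finset.coe_filter, Set.mem_ofPred_eq, mem_cells] at hc
    have := (h.apply_lt_apply_iff hn hc.1.1 hc.1.2).1 hc.2
    simp only [Prod.mk.injEq]
    omega
  · rintro ⟨a, b⟩ -
    simp

/-- The complement of a maximal filling has exactly `(n - 2K).choose 2` cells. -/
lemma IsMaximalFilling.card_compl {n K : ℕ} {F : Finset (ℕ × ℕ)} (hF : IsMaximalFilling n K F)
    (hn : 2 * K ≤ n) : (cells n \ F).card = (n - 2 * K).choose 2 := by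
  have hs := isStickyRouting_stickyState n F
  have h := hF.isReducedRouting hs
  have hle : ∀ p ≤ n, crossRank (stickyState n F n 0) p ≤ K := fun p hp =>
    (hs.crossRank_le_chainLength hp).trans (hF.chainLength_le p hp)
  have hu : IsRankMaximal n K (stickyState n F n 0) :=
    { fix := fun s hs' => h.apply_of_ge hs' n 0 (Nat.zero_le _)
      le := hle
      exists_ge := fun a b => hF.exists_crossRank_ge h hle }
  rw [h.card_compl, hu.card_filter_lt hn]

/-! ### Mutually crossing cells as chains -/

/-- Two cells cross if the corresponding chords of a convex polygon do. -/
def CellsCross (c d : ℕ × ℕ) : Prop :=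
  (c.1 < d.1 ∧ d.1 < c.2 ∧ c.2 < d.2) ∨ (d.1 < c.1 ∧ c.1 < d.2 ∧ d.2 < c.2)

/-- Crossing cells are ordered the same way in both coordinates, so a cell of S in row i is the
largest one. -/
lemma card_le_chainLength {F : Finset (ℕ × ℕ)} {p i d : ℕ} {S : Finset (ℕ × ℕ)} (hS : S ⊆ F)
    (hi : ∀ c ∈ S, c.1 < i) (hp : ∀ c ∈ S, p ≤ c.2) (hd : ∀ c ∈ S, c.2 < p + d)
    (hc : (S : Set (ℕ × ℕ)).Pairwise CellsCross) : S.card ≤ chainLength F p i d := by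
  have hempty : ∀ T : Finset (ℕ × ℕ), (∀ c ∈ T, False) → T.card = 0 := fun T hT =>
    Finset.card_eq_zero.2 (Finset.eq_empty_of_forall_notMem hT)
  induction i generalizing d S with
  | zero =>
    rw [hempty S fun c hcS => absurd (hi c hcS) (Nat.not_lt_zero _)]
    exact Nat.zero_le _
  | succ i ih =>
    induction d with
    | zero =>
      rw [hempty S fun c hcS => by have := hp c hcS; have := hd c hcS; omega]
      exact Nat.zero_le _
    | succ d ihd =>
      rw [chainLength]
      by_cases hm : (i, p + d) ∈ S
      · refine le_max_of_le_right ?_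
        rw [if_pos (hS hm), ← Finset.card_erase_add_one hm]
        have key : ∀ c ∈ S.erase (i, p + d), c.1 < i ∧ c.2 < p + d := fun c hcS => by
          obtain ⟨hne, hcS⟩ := Finset.mem_erase.1 hcS
          have := hi c hcS
          have := hd c hcS
          rcases hc hcS hm hne with h | h <;> simp only at h <;> omega
        exact Nat.add_le_add_right (ih ((Finset.erase_subset _ _).trans hS)
          (fun c hcS => (key c hcS).1) (fun c hcS => hp c (Finset.mem_of_mem_erase hcS))
          (fun c hcS => (key c hcS).2) (hc.mono (by simp))) 1
      · refine le_max_of_le_left (le_max_iff.2 ?_)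
        -- The largest cell of S bounds all columns, so if it lies in row i but not in column p + d,
        -- that column is free of S.
        by_cases hrow : ∃ c ∈ S, c.1 = i
        · right
          obtain ⟨⟨a, b⟩, hcS, rfl⟩ := hrow
          refine ihd fun e he => ?_
          have h1 := hd _ hcS
          have h2 := hd _ he
          have h3 := hi _ he
          have h4 : b ≠ p + d := by rintro rfl; exact hm hcS
          by_cases hne : e = (a, b)
          · subst hne; simp only at h1 ⊢; omega
          · simp only at h1 h3
            rcases hc he hcS hne with h | h <;> simp only at h <;> omega
        · left
          refine ih hS (fun e he => ?_) hp hd hc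
          have := hi e he
          have : e.1 ≠ i := fun h => hrow ⟨e, he, h⟩
          omega

/-- Since i ≤ p, every first coordinate is below every second one, so increasing cells do cross. -/
lemma exists_card_eq_chainLength (F : Finset (ℕ × ℕ)) (p i d : ℕ) (hip : i ≤ p) :
    ∃ S ⊆ F, (∀ c ∈ S, c.1 < i ∧ p ≤ c.2 ∧ c.2 < p + d) ∧
      (S : Set (ℕ × ℕ)).Pairwise CellsCross ∧ S.card = chainLength F p i d := by
  induction i generalizing d with
  | zero => exact ⟨∅, by simp, by simp, by simp, by simp [chainLength]⟩
  | succ i ih =>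
    induction d with
    | zero => exact ⟨∅, by simp, by simp, by simp, by simp [chainLength]⟩
    | succ d ihd =>
      rw [chainLength]
      rcases max_choice (max (chainLength F p i (d + 1)) (chainLength F p (i + 1) d))
        (if (i, p + d) ∈ F then chainLength F p i d + 1 else 0) with e | e
      · rw [e]
        rcases max_choice (chainLength F p i (d + 1)) (chainLength F p (i + 1) d) with e | e
        · obtain ⟨S, h1, h2, h3, h4⟩ := ih (d + 1) (by omega)
          exact ⟨S, h1, fun c hc => by have := h2 c hc; omega, h3, by rw [e, h4]⟩
        · obtain ⟨S, h1, h2, h3, h4⟩ := ihd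
          exact ⟨S, h1, fun c hc => by have := h2 c hc; omega, h3, by rw [e, h4]⟩
      · rw [e]
        split_ifs with hF
        · obtain ⟨S, h1, h2, h3, h4⟩ := ih d (by omega)
          have hn : (i, p + d) ∉ S := fun hm => by have := h2 _ hm; simp at this
          refine ⟨insert (i, p + d) S, Finset.insert_subset hF h1, ?_, ?_, ?_⟩
          · intro c hc
            rcases Finset.mem_insert.1 hc with rfl | hc
            · simp only; omega
            · have := h2 c hc; omega
          · rw [Finset.coe_insert]
            refine h3.insert fun c hc _ => ?_
            have := h2 c hc
            simp only [CellsCross]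
            omega
          · rw [Finset.card_insert_of_notMem hn, h4]
        · exact ⟨∅, by simp, by simp, by simp, by simp⟩

/-- Pairwise crossing cells lie in a common rectangle. -/
lemma exists_card_le_chainLength {n : ℕ} {F S : Finset (ℕ × ℕ)} (hF : F ⊆ cells n) (hS : S ⊆ F)
    (hc : (S : Set (ℕ × ℕ)).Pairwise CellsCross) :
    ∃ p ≤ n, S.card ≤ chainLength F p p (n - p) ∧ S.card ≤ p ∧ S.card ≤ n - p := by
  rcases S.eq_empty_or_nonempty with rfl | hne
  · exact ⟨0, Nat.zero_le _, by simp⟩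
  -- The cut is the smallest second coordinate: a cell that crosses m must start before m ends.
  obtain ⟨m, hm, hmin⟩ := S.exists_min_image Prod.snd hne
  have hcell : ∀ c ∈ S, c.1 < c.2 ∧ c.2 < n := fun c hcS => mem_cells.1 (hF (hS hcS))
  have hlt : ∀ c ∈ S, c.1 < m.2 := fun c hcS => by
    have h1 := hcell c hcS
    by_cases hcm : c = m
    · rw [hcm] at h1 ⊢; omega
    · have h2 := hmin c hcS
      rcases hc hcS hm hcm with h | h <;> omega
  have hmn := hcell m hm
  refine ⟨m.2, by omega, card_le_chainLength hS hlt (fun c hcS => hmin c hcS)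
    (fun c hcS => by have := hcell c hcS; omega) hc, ?_, ?_⟩
  · rw [← Finset.card_range m.2]
    refine Finset.card_le_card_of_injOn Prod.fst (fun c hcS => by simpa using hlt c hcS) ?_
    intro c hcS e he hce
    by_contra hne
    rcases hc hcS he hne with h | h <;> omega
  · rw [← Nat.card_Ico]
    refine Finset.card_le_card_of_injOn Prod.snd
      (fun c hcS => by simpa using ⟨hmin c hcS, (hcell c hcS).2⟩) ?_
    intro c hcS e he hce
    by_contra hne
    rcases hc hcS he hne with h | h <;> omega

/-- The number of cells of a set that is maximal without `K + 1` pairwise crossing cells. -/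
theorem card_of_maximal_crossing_free {n K : ℕ} {F : Finset (ℕ × ℕ)} (hF : F ⊆ cells n)
    (hfree : ∀ S ⊆ F, (S : Set (ℕ × ℕ)).Pairwise CellsCross → S.card ≠ K + 1)
    (hmax : ∀ c ∈ cells n, c ∉ F → ∃ S ⊆ insert c F,
      (S : Set (ℕ × ℕ)).Pairwise CellsCross ∧ S.card = K + 1) :
    (n ≤ 2 * K + 1 → F.card = n.choose 2) ∧
      (2 * K ≤ n → F.card + (n - 2 * K).choose 2 = n.choose 2) := by
  constructor
  · intro hn
    rw [← card_cells]
    congr 1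
    refine hF.antisymm fun c hc => ?_
    by_contra hcF
    obtain ⟨S, h1, h2, h3⟩ := hmax c hc hcF
    -- K + 1 mutually crossing cells need K + 1 points on either side of the cut, hence 2K + 2 ≤ n.
    obtain ⟨p, hp, -, h4, h5⟩ := exists_card_le_chainLength (Finset.insert_subset hc hF) h1 h2
    omega
  · intro hn
    have hmf : IsMaximalFilling n K F :=
      { chainLength_le := fun p hp => by
          by_contra hlt
          obtain ⟨S, h1, -, h3, h4⟩ := exists_card_eq_chainLength F p p (n - p) le_rfl
          obtain ⟨T, hT, hTc⟩ := Finset.exists_subset_card_eq (s := S) (n := K + 1) (by omega)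
          exact hfree T (hT.trans h1) (h3.mono (by exact_mod_cast hT)) hTc
        maximal := fun c hc hcF => by
          obtain ⟨S, h1, h2, h3⟩ := hmax c hc hcF
          obtain ⟨p, hp, h4, -⟩ := exists_card_le_chainLength (Finset.insert_subset hc hF) h1 h2
          exact ⟨p, hp, by omega⟩ }
    rw [← hmf.card_compl hn, ← card_cells, add_comm, Finset.card_sdiff_add_card_eq_card hF]

/-! ### Points in convex position -/

/-- Twice the signed area of the triangle `abc`. -/
def orient (a b c : Plane) : ℝ := (b 0 - a 0) * (c 1 - a 1) - (b 1 - a 1) * (c 0 - a 0)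

lemma plane_ext {a b : Plane} (h0 : a 0 = b 0) (h1 : a 1 = b 1) : a = b := by
  ext i
  fin_cases i
  · exact h0
  · exact h1

section ConvexPosition

variable {V : Type*} {p : V → Plane}

lemma ConvexIndependent.ne_combination (hp : ConvexIndependent ℝ p) {a b c d : V} (ha : d ≠ a)
    (hb : d ≠ b) (hc : d ≠ c) {x y z : ℝ} (hx : 0 ≤ x) (hy : 0 ≤ y) (hz : 0 ≤ z)
    (hsum : x + y + z = 1) : p d ≠ x • p a + y • p b + z • p c := by
  intro h
  have hmem : p d ∈ convexHull ℝ (p '' {a, b, c}) := by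
    rw [h]
    have := (convex_convexHull ℝ (p '' {a, b, c})).sum_mem (t := (Finset.univ : Finset (Fin 3)))
      (w := ![x, y, z]) (z := ![p a, p b, p c])
      (by intro i _; fin_cases i <;> simpa) (by simpa [Fin.sum_univ_three] using hsum)
      (by intro i _; apply subset_convexHull; fin_cases i <;> simp)
    simpa [Fin.sum_univ_three] using this
  have := hp _ _ hmem
  simp [ha, hb, hc] at this

/-- The ratios of signed areas are the barycentric coordinates of `p d` in the triangle. -/
lemma ConvexIndependent.not_inside (hp : ConvexIndependent ℝ p) {a b c d : V} (ha : d ≠ a)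
    (hb : d ≠ b) (hc : d ≠ c) (h1 : 0 ≤ orient (p d) (p b) (p c))
    (h2 : 0 ≤ orient (p a) (p d) (p c)) (h3 : 0 ≤ orient (p a) (p b) (p d))
    (h : 0 < orient (p a) (p b) (p c)) : False := by
  have hne := h.ne'
  refine hp.ne_combination ha hb hc (div_nonneg h1 h.le) (div_nonneg h2 h.le) (div_nonneg h3 h.le)
    ?_ (plane_ext ?_ ?_)
  · rw [← add_div, ← add_div, div_eq_one_iff_eq hne]
    simp only [orient]; ring
  · simp only [PiLp.add_apply, PiLp.smul_apply, smul_eq_mul]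
    field_simp
    simp only [orient]; ring
  · simp only [PiLp.add_apply, PiLp.smul_apply, smul_eq_mul]
    field_simp
    simp only [orient]; ring

lemma exists_eq_lineMap_of_orient_eq_zero {a b c : Plane} (hab : a ≠ b) (h : orient a b c = 0) :
    ∃ t : ℝ, c = (1 - t) • a + t • b := by
  have h' : b 0 - a 0 ≠ 0 ∨ b 1 - a 1 ≠ 0 := by
    by_contra hc
    push Not at hc
    exact hab (plane_ext (by linarith [hc.1]) (by linarith [hc.2]))
  simp only [orient] at h
  rcases h' with h' | h'
  · refine ⟨(c 0 - a 0) / (b 0 - a 0), plane_ext ?_ ?_⟩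
    · simp only [PiLp.add_apply, PiLp.smul_apply, smul_eq_mul]
      field_simp; ring
    · simp only [PiLp.add_apply, PiLp.smul_apply, smul_eq_mul]
      field_simp; linarith
  · refine ⟨(c 1 - a 1) / (b 1 - a 1), plane_ext ?_ ?_⟩
    · simp only [PiLp.add_apply, PiLp.smul_apply, smul_eq_mul]
      field_simp; linarith
    · simp only [PiLp.add_apply, PiLp.smul_apply, smul_eq_mul]
      field_simp; ring

/-- Of three collinear points one lies between the other two; the sign of t and its comparison with
1 tell which. -/
lemma ConvexIndependent.orient_ne_zero (hp : ConvexIndependent ℝ p) {a b c : V} (hab : a ≠ b)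
    (hac : a ≠ c) (hbc : b ≠ c) : orient (p a) (p b) (p c) ≠ 0 := by
  intro h
  obtain ⟨t, ht⟩ := exists_eq_lineMap_of_orient_eq_zero (hp.injective.ne hab) h
  have e0 := congrArg (fun x : Plane => x 0) ht
  have e1 := congrArg (fun x : Plane => x 1) ht
  simp only [PiLp.add_apply, PiLp.smul_apply, smul_eq_mul] at e0 e1
  rcases lt_or_ge t 0 with h0 | h0
  · have hpos : 0 < 1 - t := by linarith
    refine hp.ne_combination (a := c) (b := b) (c := b) (d := a) hac hab hab
      (x := 1 / (1 - t)) (y := -t / (1 - t)) (z := 0) (by positivity)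
      (div_nonneg (by linarith) hpos.le) le_rfl (by field_simp; ring) (plane_ext ?_ ?_)
    · simp only [PiLp.add_apply, PiLp.smul_apply, smul_eq_mul]
      field_simp; linarith
    · simp only [PiLp.add_apply, PiLp.smul_apply, smul_eq_mul]
      field_simp; linarith
  · rcases le_or_gt t 1 with h1 | h1
    · refine hp.ne_combination (a := a) (b := b) (c := b) (d := c) hac.symm hbc.symm hbc.symm
        (x := 1 - t) (y := t) (z := 0) (by linarith) h0 le_rfl (by ring) ?_
      rw [ht]; simp
    · have hpos : 0 < t := by linarith
      refine hp.ne_combination (a := c) (b := a) (c := a) (d := b) hbc hab.symm hab.symm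
        (x := 1 / t) (y := (t - 1) / t) (z := 0) (by positivity)
        (div_nonneg (by linarith) hpos.le) le_rfl (by field_simp; ring) (plane_ext ?_ ?_)
      · simp only [PiLp.add_apply, PiLp.smul_apply, smul_eq_mul]
        field_simp; linarith
      · simp only [PiLp.add_apply, PiLp.smul_apply, smul_eq_mul]
        field_simp; linarith

lemma orient_swap (a b c : Plane) : orient a c b = - orient a b c := by
  simp only [orient]; ring

lemma orient_rotate (a b c : Plane) : orient b c a = orient a b c := by
  simp only [orient]; ring

lemma orient_self_right (a b : Plane) : orient a b b = 0 := by
  simp only [orient]; ring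

lemma orient_self_left (a b : Plane) : orient a b a = 0 := by
  simp only [orient]; ring

lemma orient_add_smul (a b c d : Plane) {s t : ℝ} (h : s + t = 1) :
    orient a b (s • c + t • d) = s * orient a b c + t * orient a b d := by
  obtain rfl : s = 1 - t := by linarith
  simp only [orient, PiLp.add_apply, PiLp.smul_apply, smul_eq_mul]; ring

/-- Points in convex position can be numbered in counterclockwise order. -/
lemma ConvexIndependent.exists_cyclic_order [Fintype V] (hp : ConvexIndependent ℝ p) :
    ∃ e : V ≃ Fin (Fintype.card V), ∀ a b c, e a < e b → e b < e c →
      0 < orient (p a) (p b) (p c) := by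
  classical
  rcases isEmpty_or_nonempty V with hV | ⟨⟨v⟩⟩
  · exact ⟨Fintype.equivFin V, fun a => hV.elim a⟩
  -- The vertices are sorted by angle around v, which comes first. Transitivity is where convex
  -- position enters.
  let r : V → V → Prop := fun a b => b ≠ v ∧ (a = v ∨ 0 < orient (p v) (p a) (p b))
  have hirr : ∀ a, ¬ r a a := by
    rintro a ⟨h, h' | h'⟩
    · exact h h'
    · rw [orient_self_right] at h'; exact lt_irrefl _ h'
  have htrans : ∀ a b c, r a b → r b c → r a c := by
    rintro a b c ⟨hb, hab⟩ ⟨hc, hbc⟩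
    refine ⟨hc, or_iff_not_imp_left.2 fun ha => ?_⟩
    have hab := hab.resolve_left ha
    have hbc := hbc.resolve_left hb
    have hac : a ≠ c := by
      rintro rfl
      rw [orient_swap] at hab
      linarith
    by_contra hneg
    have hlt : orient (p v) (p a) (p c) < 0 :=
      lt_of_le_of_ne (not_lt.1 hneg) (hp.orient_ne_zero (Ne.symm ha) (Ne.symm hc) hac)
    -- Otherwise v would lie in the triangle abc.
    refine hp.not_inside (a := a) (b := b) (c := c) (d := v) (Ne.symm ha) (Ne.symm hb) (Ne.symm hc)
      hbc.le ?_ ?_ ?_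
    · have := orient_rotate (p a) (p v) (p c)
      rw [← this, orient_swap]; linarith
    · have := orient_rotate (p v) (p a) (p b)
      linarith
    · have : orient (p a) (p b) (p c) = orient (p v) (p a) (p b) + orient (p v) (p b) (p c)
        - orient (p v) (p a) (p c) := by simp only [orient]; ring
      linarith
  have htri : ∀ a b, ¬ r a b → ¬ r b a → a = b := by
    intro a b hab hba
    by_contra hne
    by_cases ha : a = v
    · exact hab ⟨fun hb => hne (ha.trans hb.symm), Or.inl ha⟩
    by_cases hb : b = v
    · exact hba ⟨ha, Or.inl hb⟩
    rcases lt_or_gt_of_ne (hp.orient_ne_zero (Ne.symm ha) (Ne.symm hb) hne) with h | h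
    · exact hba ⟨ha, Or.inr (by rw [orient_swap]; linarith)⟩
    · exact hab ⟨hb, Or.inr h⟩
  have key : ∀ a b c, r a b → r b c → 0 < orient (p a) (p b) (p c) := by
    intro a b c hab hbc
    have hac := htrans a b c hab hbc
    by_cases ha : a = v
    · subst ha
      exact hbc.2.resolve_left hab.1
    · have n1 : a ≠ b := by rintro rfl; exact hirr _ hab
      have n2 : a ≠ c := by rintro rfl; exact hirr _ hac
      have n3 : b ≠ c := by rintro rfl; exact hirr _ hbc
      have h1 := hab.2.resolve_left ha
      have h2 := hbc.2.resolve_left hab.1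
      have h3 := hac.2.resolve_left ha
      by_contra hneg
      have := orient_swap (p b) (p c) (p a)
      have := orient_rotate (p a) (p b) (p c)
      -- Otherwise b would lie in the triangle vac.
      exact hp.not_inside (a := v) (b := a) (c := c) (d := b) hab.1 n1.symm n3
        (by linarith) h2.le h1.le h3
  have : IsStrictTotalOrder V r :=
    { trichotomous := htri, irrefl := hirr, trans := htrans }
  let : LinearOrder V := linearOrderOfSTO r
  let o : Fin (Fintype.card V) ≃o V := Fintype.orderIsoFinOfCardEq V rfl
  exact ⟨o.symm.toEquiv, fun a b c hab hbc =>
    key a b c (o.symm.lt_iff_lt.1 hab) (o.symm.lt_iff_lt.1 hbc)⟩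

end ConvexPosition

/-- The diagonals divide each other in the ratio of triangle areas. The common denominator is the
area of the quadrilateral, split along either diagonal. -/
lemma openSegment_inter_nonempty {a b c d : Plane} (h1 : 0 < orient a b c) (h2 : 0 < orient a b d)
    (h3 : 0 < orient a c d) (h4 : 0 < orient b c d) :
    (openSegment ℝ a c ∩ openSegment ℝ b d).Nonempty := by
  have hs : 0 < orient b c d + orient a b d := by linarith
  have hs' : orient a c d + orient a b c = orient b c d + orient a b d := by
    simp only [orient]; ring
  refine ⟨(orient b c d / (orient b c d + orient a b d)) • a +
    (orient a b d / (orient b c d + orient a b d)) • c,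
    ⟨_, _, by positivity, by positivity, by field_simp, rfl⟩,
    ⟨orient a c d / (orient b c d + orient a b d), orient a b c / (orient b c d + orient a b d),
      by positivity, by positivity, ?_, plane_ext ?_ ?_⟩⟩
  · rw [← add_div, hs', div_self hs.ne']
  · simp only [PiLp.add_apply, PiLp.smul_apply, smul_eq_mul]
    field_simp
    simp only [orient]; ring
  · simp only [PiLp.add_apply, PiLp.smul_apply, smul_eq_mul]
    field_simp
    simp only [orient]; ring

/-- The points c and d are strictly on one side of the line ab, and `orient a b` is affine in its
last argument. -/
lemma openSegment_inter_eq_empty {a b c d : Plane} (h : 0 < orient a b c * orient a b d) :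
    ¬ (openSegment ℝ a b ∩ openSegment ℝ c d).Nonempty := by
  rintro ⟨x, ⟨s, t, hs, ht, hst, rfl⟩, ⟨s', t', hs', ht', hst', he⟩⟩
  have h1 := orient_add_smul a b a b hst
  rw [← he, orient_add_smul a b c d hst', orient_self_left, orient_self_right] at h1
  rcases pos_and_pos_or_neg_and_neg_of_mul_pos h with ⟨h2, h3⟩ | ⟨h2, h3⟩
  · nlinarith [mul_pos hs' h2, mul_pos ht' h3]
  · nlinarith [mul_pos hs' (neg_pos.2 h2), mul_pos ht' (neg_pos.2 h3)]

lemma edgesCross_mk {V : Type*} {p : V → Plane} {a b c d : V} :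
    EdgesCross p s(a, b) s(c, d) ↔ a ≠ c ∧ a ≠ d ∧ b ≠ c ∧ b ≠ d ∧
      (openSegment ℝ (p a) (p b) ∩ openSegment ℝ (p c) (p d)).Nonempty := by
  constructor
  · rintro ⟨a', b', c', d', h1, h2, h⟩
    rcases Sym2.eq_iff.1 h1 with ⟨rfl, rfl⟩ | ⟨rfl, rfl⟩ <;>
      rcases Sym2.eq_iff.1 h2 with ⟨rfl, rfl⟩ | ⟨rfl, rfl⟩ <;>
      simp only [openSegment_symm ℝ (p a) (p b), openSegment_symm ℝ (p c) (p d)] at h ⊢ <;>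
      tauto
  · exact fun h => ⟨a, b, c, d, rfl, rfl, h⟩

/-! ### Chords of the polygon as cells -/

section Chords

variable {V : Type*} {n : ℕ} (e : V ≃ Fin n)

/-- The cell of the chord between two vertices that are numbered by `e`. -/
def chordCell : Sym2 V → ℕ × ℕ :=
  Sym2.lift ⟨fun a b => (min (e a : ℕ) (e b), max (e a : ℕ) (e b)), fun a b => by
    simp only [min_comm, max_comm]⟩

lemma chordCell_mk (a b : V) :
    chordCell e s(a, b) = (min (e a : ℕ) (e b), max (e a : ℕ) (e b)) := rfl

lemma chordCell_of_lt {a b : V} (h : e a < e b) : chordCell e s(a, b) = ((e a : ℕ), (e b : ℕ)) := by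
  have h' : (e a : ℕ) < e b := h
  rw [chordCell_mk, min_eq_left h'.le, max_eq_right h'.le]

lemma exists_lt_of_not_isDiag {z : Sym2 V} (hz : ¬ z.IsDiag) : ∃ a b, e a < e b ∧ z = s(a, b) := by
  induction z with
  | _ a b =>
    have hne : e a ≠ e b := fun h => hz (e.injective h)
    rcases lt_or_gt_of_ne hne with h | h
    · exact ⟨a, b, h, rfl⟩
    · exact ⟨b, a, h, Sym2.eq_swap⟩

lemma chordCell_injective : Function.Injective (chordCell e) := by
  intro z w h
  induction z with
  | _ a b =>
    induction w with
    | _ c d =>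
      simp only [chordCell_mk, Prod.mk.injEq] at h
      have : ((e a : ℕ) = e c ∧ (e b : ℕ) = e d) ∨ ((e a : ℕ) = e d ∧ (e b : ℕ) = e c) := by omega
      simp only [← Fin.ext_iff, e.injective.eq_iff] at this
      exact Sym2.eq_iff.2 this

lemma chordCell_mem_cells {z : Sym2 V} (hz : ¬ z.IsDiag) : chordCell e z ∈ cells n := by
  obtain ⟨a, b, hab, rfl⟩ := exists_lt_of_not_isDiag e hz
  rw [chordCell_of_lt e hab, mem_cells]
  exact ⟨hab, (e b).2⟩

variable {e}

/-- Chords of points in convex position cross if and only if their end points interleave. -/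
lemma edgesCross_iff {p : V → Plane}
    (he : ∀ a b c, e a < e b → e b < e c → 0 < orient (p a) (p b) (p c)) {z w : Sym2 V}
    (hz : ¬ z.IsDiag) (hw : ¬ w.IsDiag) :
    EdgesCross p z w ↔ CellsCross (chordCell e z) (chordCell e w) := by
  obtain ⟨a, b, hab, rfl⟩ := exists_lt_of_not_isDiag e hz
  obtain ⟨c, d, hcd, rfl⟩ := exists_lt_of_not_isDiag e hw
  -- Of two disjoint chords, let ab have the smaller first end. If the ends do not interleave, c and
  -- d are on the same side of ab.
  have key : ∀ a b c d : V, e a < e b → e c < e d → e a < e c →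
      (openSegment ℝ (p a) (p b) ∩ openSegment ℝ (p c) (p d)).Nonempty → e b ≠ e c → e b ≠ e d →
      e c < e b ∧ e b < e d := by
    intro a b c d hab hcd hac hne h1 h2
    by_contra hcon
    refine openSegment_inter_eq_empty ?_ hne
    rcases lt_or_gt_of_ne h1 with h | h
    · exact mul_pos (he _ _ _ hab h) (he _ _ _ hab (h.trans hcd))
    · rcases lt_or_gt_of_ne h2 with h' | h'
      · exact absurd ⟨h, h'⟩ hcon
      · rw [orient_swap (p a) (p c), orient_swap (p a) (p d), neg_mul_neg]
        exact mul_pos (he _ _ _ hac h) (he _ _ _ (hac.trans hcd) h')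
  rw [edgesCross_mk, chordCell_of_lt e hab, chordCell_of_lt e hcd]
  simp only [CellsCross, Fin.val_fin_lt]
  constructor
  · rintro ⟨h1, h2, h3, h4, hne⟩
    rcases lt_or_gt_of_ne (e.injective.ne h1) with h | h
    · have := key a b c d hab hcd h hne (e.injective.ne h3) (e.injective.ne h4)
      exact Or.inl ⟨h, this⟩
    · rw [Set.inter_comm] at hne
      have := key c d a b hcd hab h hne (e.injective.ne h2.symm) (e.injective.ne h4.symm)
      exact Or.inr ⟨h, this⟩
  · rintro (⟨h1, h2, h3⟩ | ⟨h1, h2, h3⟩)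
    · refine ⟨?_, ?_, ?_, ?_, openSegment_inter_nonempty (he _ _ _ h1 h2)
        (he _ _ _ h1 (h2.trans h3)) (he _ _ _ hab h3) (he _ _ _ h2 h3)⟩ <;> rintro rfl <;> omega
    · rw [Set.inter_comm]
      refine ⟨?_, ?_, ?_, ?_, openSegment_inter_nonempty (he _ _ _ h1 h2)
        (he _ _ _ h1 (h2.trans h3)) (he _ _ _ hcd h3) (he _ _ _ h2 h3)⟩ <;> rintro rfl <;> omega

end Chords

/-! ### From the drawing to the filling -/

theorem theorem5 {V : Type*} [Fintype V] (k : ℕ) (hk : 1 ≤ k) (G : SimpleGraph V) (p : V → Plane)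
    (hG : IsMaximalOuterQuasiPlanarDrawing k G p) :
    (Fintype.card V ≤ 2 * k - 1 → G.edgeSet.ncard = (Fintype.card V).choose 2) ∧
    (2 * k - 1 ≤ Fintype.card V →
      (G.edgeSet.ncard : ℤ) =
        2 * ((k : ℤ) - 1) * (Fintype.card V : ℤ) - ((2 * k - 1).choose 2 : ℤ)) := by
  classical
  obtain ⟨K, rfl⟩ : ∃ K, k = K + 1 := ⟨k - 1, by omega⟩
  have hp := hG.isOuterQuasiPlanarDrawing.convexPosition
  obtain ⟨e, he⟩ := hp.exists_cyclic_order
  generalize Fintype.card V = n at *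
  let E : Finset (Sym2 V) := (Set.toFinite G.edgeSet).toFinset
  have hE : ∀ z, z ∈ E ↔ z ∈ G.edgeSet := fun z => by simp [E]
  have hdiag : ∀ (H : SimpleGraph V), ∀ z ∈ H.edgeSet, ¬ z.IsDiag := fun H z hz =>
    H.not_isDiag_of_mem_edgeSet hz
  have hcard : G.edgeSet.ncard = (E.image (chordCell e)).card := by
    rw [Finset.card_image_of_injective _ (chordCell_injective e),
      Set.ncard_eq_toFinset_card _ (Set.toFinite _)]
  have hsub : E.image (chordCell e) ⊆ cells n := by
    intro c hc
    obtain ⟨z, hz, rfl⟩ := Finset.mem_image.1 hc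
    exact chordCell_mem_cells e (hdiag G z ((hE z).1 hz))
  have main := card_of_maximal_crossing_free (K := K) hsub ?_ ?_
  · rw [← hcard] at main
    refine ⟨fun hn => main.1 (by omega), fun hn => ?_⟩
    have h2 := main.2 (by omega)
    -- This form of n removes the truncated subtractions; the identity of binomial coefficients is
    -- then checked in ℚ, where the halves are harmless.
    obtain ⟨m, hm⟩ : ∃ m, n = 2 * K + 1 + m := ⟨n - (2 * K + 1), by omega⟩
    rw [hm] at h2 ⊢
    have e1 : 2 * K + 1 + m - 2 * K = m + 1 := by omega
    have e2 : 2 * (K + 1) - 1 = 2 * K + 1 := by omega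
    rw [e1] at h2
    rw [e2]
    have c1 : (((2 * K + 1 + m).choose 2 : ℕ) : ℚ) = _ := Nat.cast_choose_two ℚ _
    have c2 : (((m + 1).choose 2 : ℕ) : ℚ) = _ := Nat.cast_choose_two ℚ _
    have c3 : (((2 * K + 1).choose 2 : ℕ) : ℚ) = _ := Nat.cast_choose_two ℚ _
    have h2' : (G.edgeSet.ncard : ℚ) + ((m + 1).choose 2 : ℕ) = ((2 * K + 1 + m).choose 2 : ℕ) := by
      exact_mod_cast h2
    have : (G.edgeSet.ncard : ℚ) = 2 * (((K + 1 : ℕ) : ℚ) - 1) * ((2 * K + 1 + m : ℕ) : ℚ) -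
        ((2 * K + 1).choose 2 : ℕ) := by
      rw [c1, c2] at h2'
      rw [c3]
      push_cast at h2' ⊢
      linarith
    exact_mod_cast this
  · intro S hS hc hS'
    refine hG.isOuterQuasiPlanarDrawing.no_mutual_crossing
      ⟨E.filter fun z => chordCell e z ∈ S, fun z hz => (hE z).1 (Finset.mem_filter.1 hz).1, ?_, ?_⟩
    · rw [← hS', ← Finset.card_image_of_injective _ (chordCell_injective e)]
      congr 1
      ext c
      simp only [Finset.mem_image, Finset.mem_filter]
      constructor
      · rintro ⟨z, ⟨-, hz⟩, rfl⟩
        exact hz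
      · intro hcS
        obtain ⟨z, hz, rfl⟩ := Finset.mem_image.1 (hS hcS)
        exact ⟨z, ⟨hz, hcS⟩, rfl⟩
    · intro z hz w hw hzw
      obtain ⟨hz1, hz2⟩ := Finset.mem_filter.1 hz
      obtain ⟨hw1, hw2⟩ := Finset.mem_filter.1 hw
      rw [edgesCross_iff he (hdiag G z ((hE z).1 hz1)) (hdiag G w ((hE w).1 hw1))]
      exact hc hz2 hw2 ((chordCell_injective e).ne hzw)
  · rintro ⟨i, j⟩ hc hcF
    obtain ⟨hij, hj⟩ := mem_cells.1 hc
    obtain ⟨u, hu⟩ := e.surjective ⟨i, hij.trans hj⟩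
    obtain ⟨v, hv⟩ := e.surjective ⟨j, hj⟩
    have huv : e u < e v := by rw [hu, hv]; exact hij
    have hcell : chordCell e s(u, v) = (i, j) := by rw [chordCell_of_lt e huv, hu, hv]
    have hne : u ≠ v := by rintro rfl; exact lt_irrefl _ huv
    have hadj : ¬ G.Adj u v := fun h =>
      hcF (Finset.mem_image.2 ⟨s(u, v), (hE _).2 h, hcell⟩)
    have hnot := hG.maximal u v hne hadj
    have hex : ∃ S : Finset (Sym2 V), (S : Set (Sym2 V)) ⊆ (G ⊔ SimpleGraph.edge u v).edgeSet ∧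
        S.card = K + 1 ∧ (S : Set (Sym2 V)).Pairwise (EdgesCross p) := by
      by_contra h
      exact hnot ⟨hp, h⟩
    obtain ⟨S, h1, h2, h3⟩ := hex
    refine ⟨S.image (chordCell e), ?_, ?_, ?_⟩
    · intro c hcS
      obtain ⟨z, hz, rfl⟩ := Finset.mem_image.1 hcS
      have := h1 hz
      rw [SimpleGraph.edgeSet_sup, SimpleGraph.edgeSet_edge_of_ne hne] at this
      rcases this with hz' | rfl
      · exact Finset.mem_insert_of_mem (Finset.mem_image_of_mem _ ((hE z).2 hz'))
      · rw [hcell]; exact Finset.mem_insert_self _ _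
    · intro c hcS d hdS hcd
      obtain ⟨z, hz, rfl⟩ := Finset.mem_image.1 hcS
      obtain ⟨w, hw, rfl⟩ := Finset.mem_image.1 hdS
      rw [← edgesCross_iff he (hdiag _ z (h1 hz)) (hdiag _ w (h1 hw))]
      exact h3 hz hw fun h => hcd (by rw [h])
    · rw [Finset.card_image_of_injective _ (chordCell_injective e), h2]
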